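/- **Setting.** Let $M$ be a Riemannian spin manifold of even dimension $2n\ge 4$ with metric $g$ and Levi-Civita connection $\nabla$. Let $S$ be its complex spinor bundle (rank $2^n$), with Clifford multiplication $\gamma(X)\phi=X\phi$, $XY+YX=-2g(X,Y)$, with a charge conjugation $C$ (a smooth nondegenerate complex bilinear form with $C(\phi,\psi)=\Delta_0C(\psi,\phi)$ and $C(\phi,X\psi)=\Delta_1C(\psi,X\phi)$, $\Delta_0,\Delta_1\in\{\pm1\}$), and with the Levi-Civita connection, also written $\nabla$, for which $\gamma$ and $C$ are parallel. Write $\gamma_{A_1\ldots A_k}=\gamma_{[A_1}\cdots\gamma_{A_k]}$ for antisymmetrised products (with factor $\frac1{k!}$). For $\Phi\in\mathrm{End}(S)$ let $\Phi^C$ be given by $C(\Phi^C\eta,\xi)=C(\eta,\Phi\xi)$. To a connection $D=\nabla+\mathcal A$ on $S$, $\mathcal A\in\Omega^1(M)\otimes\Gamma\,\mathrm{End}(S)$, one associates $D^C=\nabla-\mathcal A^C$, the expression $(\hat D_X\gamma)(Y)\xi=D_X(Y\xi)-(\nabla_XY)\xi-Y D^C_X\xi$, the torsion $\mathcal T(X,Y)=(\hat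 D_X\gamma)(Y)-(\hat D_Y\gamma)(X)\in\mathrm{End}(S)$, and, in a local orthonormal frame $(e_\mu)$ of $TM$ with $\gamma^\mu=\gamma(e_\mu)$ and $\mathcal T_{\mu\nu}=\mathcal T(e_\mu,e_\nu)$, $$\mathfrak D(\mathcal T;\varphi,\psi)=\sum_{\mu,\nu}\big(\gamma^\mu\varphi\wedge\mathcal T_{\mu\nu}\psi+\gamma^\mu\psi\wedge\mathcal T_{\mu\nu}\varphi\big)\otimes e_\nu\ \in\ \Lambda^2S\otimes TM .$$ Let $\eta$ be a pure spinor field: at every $x\in M$ the null space $N_x=\{X\in T_xM\otimes\mathbb C\mid X\eta=0\}$ has complex dimension $n$. At $x$ choose an orthonormal frame $e_1,\ldots,e_{2n}$ adapted to the complex structure given by $\eta$, i.e. such that the vectors $E_{\bar a}=e_a-i\,e_{a+n}$, $a=1,\ldots,n$, span $N_x$; put $E_a=e_a+i\,e_{a+n}$ and $\gamma^a=\gamma(E_a)$, so that $\gamma^{\bar a}\eta=\gamma(E_{\bar a})\eta=0$. For any orthonormal frame $f_1,\ldots,f_{2n}$ of $T_xM$ put $\gamma^*=\gamma(f_1)\cdots\gamma(f_{2n})$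 if $n$ is even and $\gamma^*=i\,\gamma(f_1)\cdots\gamma(f_{2n})$ if $n$ is odd, and define $w_\eta$ by $\gamma^*\eta=w_\eta\eta$ (the product $w_\eta\gamma^*$ does not depend on the orientation of $f$). **Proposition.** Let $F$ be a (possibly complex valued) 3-form on $M$ and let $D=\nabla+\mathcal A$ be the connection on $S$ given by $\mathcal A_\mu=F_{\mu\nu\kappa}\gamma^{\nu\kappa}$. Let $F^{ijk}$ be the components of $F$, regarded as a 3-vector by means of $g$, in the complex frame $(E_a,E_{\bar a})$, i.e. $F=\sum F^{ijk}E_i\otimes E_j\otimes E_k$. If at the point $x$ $$\sum_{i}\ \sum_{a_1,\ldots,a_n} F^{i\,a_{n-1}a_n}\,\varepsilon_{a_1\ldots a_n}\,\gamma^{a_1\ldots a_{n-2}}\big(\mathbb 1-(-1)^n w_\eta\gamma^*\big)\otimes E_i=0\quad\text{in }\mathrm{End}(S_x)\otimes(T_xM\otimes\mathbb C),$$ where the $a_1,\ldots,a_n$ run over the unbarred indices $1,\ldots,n$, $\varepsilon$ is the totally skew-symmetric symbol, and $i$ runs over all $2n$ barred and unbarred indices, then $\mathfrak D(\mathcal T;\eta,\eta)=0$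 at $x$. In particular, if the condition holds at every point, then $\mathfrak D(\mathcal T;\eta,\eta)=0$. -/

import Mathlib

open Bundle
open scoped Manifold ContDiff TensorProduct

noncomputable section

namespace SpinorTorsion

/-! ### Spinor bundles with charge conjugation

`M` is a smooth Riemannian manifold of dimension `2 * n` modelled on the vector space `E`, and `S`
is a smooth complex vector bundle over `M` with model fibre `F`. -/

/-- A spinor bundle over the Riemannian manifold `M` of dimension `2 * n`: the smooth complex vector
bundle `S` of rank `2 ^ n` with a smooth Clifford multiplication `γ`, `XY + YX = -2 g(X, Y)`
(so that every fibre is the irreducible complex Clifford module), together with a charge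
conjugation: a smooth nondegenerate complex bilinear form `C` for which
`C(φ, ψ) = Δ₀ C(ψ, φ)` and `C(φ, X ψ) = Δ₁ C(ψ, X φ)` with signs `Δ₀`, `Δ₁`;
in particular, `C` is invariant under the spin group. -/
structure SpinorBundle (n : ℕ) (E : Type*) [NormedAddCommGroup E] [NormedSpace ℝ E]
    (M : Type*) [TopologicalSpace M] [ChartedSpace E M] [IsManifold 𝓘(ℝ, E) ∞ M]
    [RiemannianBundle (fun x : M ↦ TangentSpace 𝓘(ℝ, E) x)]
    (F : Type*) [NormedAddCommGroup F] [NormedSpace ℂ F]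
    (S : M → Type*) [TopologicalSpace (TotalSpace F S)]
    [∀ x, AddCommGroup (S x)] [∀ x, Module ℂ (S x)] [∀ x, TopologicalSpace (S x)]
    [FiberBundle F S] where
  finrank_model : Module.finrank ℝ E = 2 * n
  finrank_fiber : ∀ x, Module.finrank ℂ (S x) = 2 ^ n
  /-- Clifford multiplication -/
  γ : ∀ x : M, TangentSpace 𝓘(ℝ, E) x →ₗ[ℝ] Module.End ℂ (S x)
  clifford : ∀ (x : M) (X Y : TangentSpace 𝓘(ℝ, E) x),
    γ x X * γ x Y + γ x Y * γ x X = (-2 * inner ℝ X Y : ℝ) • (1 : Module.End ℂ (S x))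
  smooth_γ : ∀ (X : ∀ x : M, TangentSpace 𝓘(ℝ, E) x) (σ : ∀ x, S x) (x : M),
    ContMDiffAt 𝓘(ℝ, E) (𝓘(ℝ, E).prod 𝓘(ℝ, E)) ∞ (fun y ↦ TotalSpace.mk' E y (X y)) x →
    ContMDiffAt 𝓘(ℝ, E) (𝓘(ℝ, E).prod 𝓘(ℝ, F)) ∞ (fun y ↦ TotalSpace.mk' F y (σ y)) x →
    ContMDiffAt 𝓘(ℝ, E) (𝓘(ℝ, E).prod 𝓘(ℝ, F)) ∞
      (fun y ↦ TotalSpace.mk' F y (γ y (X y) (σ y))) x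
  /-- charge conjugation -/
  C : ∀ x : M, LinearMap.BilinForm ℂ (S x)
  nondegenerate : ∀ x, (C x).Nondegenerate
  smooth_C : ∀ (φ ψ : ∀ x, S x) (x : M),
    ContMDiffAt 𝓘(ℝ, E) (𝓘(ℝ, E).prod 𝓘(ℝ, F)) ∞ (fun y ↦ TotalSpace.mk' F y (φ y)) x →
    ContMDiffAt 𝓘(ℝ, E) (𝓘(ℝ, E).prod 𝓘(ℝ, F)) ∞ (fun y ↦ TotalSpace.mk' F y (ψ y)) x →
    ContMDiffAt 𝓘(ℝ, E) 𝓘(ℝ, ℂ) ∞ (fun y ↦ C y (φ y) (ψ y)) x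
  /-- the sign `Δ₀` -/
  Δ₀ : ℤˣ
  /-- the sign `Δ₁` -/
  Δ₁ : ℤˣ
  symm_C : ∀ (x : M) (φ ψ : S x), C x φ ψ = ((Δ₀ : ℤ) : ℂ) * C x ψ φ
  symm_C_γ : ∀ (x : M) (X : TangentSpace 𝓘(ℝ, E) x) (φ ψ : S x),
    C x φ (γ x X ψ) = ((Δ₁ : ℤ) : ℂ) * C x ψ (γ x X φ)

/-- The antisymmetrised product `A_{[1} ⋯ A_{k]} = (1 / k!) ∑_σ sign(σ) A_{σ 1} ⋯ A_{σ k}`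
of endomorphisms. -/
def antisymmProd {V : Type*} [AddCommGroup V] [Module ℂ V] {k : ℕ}
    (A : Fin k → Module.End ℂ V) : Module.End ℂ V :=
  ((k.factorial : ℂ)⁻¹) • ∑ σ : Equiv.Perm (Fin k),
    ((Equiv.Perm.sign σ : ℤ) : ℂ) • (List.ofFn fun j ↦ A (σ j)).prod

variable {n : ℕ} {E : Type*} [NormedAddCommGroup E] [NormedSpace ℝ E] [FiniteDimensional ℝ E]
  {M : Type*} [TopologicalSpace M] [ChartedSpace E M] [IsManifold 𝓘(ℝ, E) ∞ M]
  [RiemannianBundle (fun x : M ↦ TangentSpace 𝓘(ℝ, E) x)]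
  {F : Type*} [NormedAddCommGroup F] [NormedSpace ℂ F]
  {S : M → Type*} [TopologicalSpace (TotalSpace F S)]
  [∀ x, AddCommGroup (S x)] [∀ x, Module ℂ (S x)] [∀ x, TopologicalSpace (S x)]
  [FiberBundle F S]

namespace SpinorBundle

theorem finiteDimensional (B : SpinorBundle n E M F S) (x : M) : FiniteDimensional ℂ (S x) :=
  FiniteDimensional.of_finrank_pos (by rw [B.finrank_fiber]; positivity)

variable (B : SpinorBundle n E M F S)

/-! ### Charge adjoint -/

/-- The charge adjoint `Φ^C` of an endomorphism: `C(Φ^C η, ξ) = C(η, Φ ξ)`. -/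
def chargeAdj (x : M) (Φ : Module.End ℂ (S x)) : Module.End ℂ (S x) :=
  haveI := B.finiteDimensional x
  (B.C x).leftAdjointOfNondegenerate (B.nondegenerate x) Φ

theorem C_chargeAdj (x : M) (Φ : Module.End ℂ (S x)) (φ ψ : S x) :
    B.C x (B.chargeAdj x Φ φ) ψ = B.C x φ (Φ ψ) :=
  haveI := B.finiteDimensional x
  LinearMap.BilinForm.isAdjointPairLeftAdjointOfNondegenerate (B.C x) (B.nondegenerate x) Φ φ ψ

theorem chargeAdj_eq {x : M} {Φ Ψ : Module.End ℂ (S x)}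
    (h : ∀ φ ψ, B.C x (Ψ φ) ψ = B.C x φ (Φ ψ)) : B.chargeAdj x Φ = Ψ := by
  have := B.finiteDimensional x
  exact ((LinearMap.BilinForm.isAdjointPair_iff_eq_of_nondegenerate (B.C x)
    (B.nondegenerate x) Ψ Φ).1 h).symm

/-- The charge adjoint `𝒜^C` of an endomorphism valued one-form `𝒜`. -/
def chargeAdjForm (A : ∀ x : M, TangentSpace 𝓘(ℝ, E) x →ₗ[ℝ] Module.End ℂ (S x)) (x : M) :
    TangentSpace 𝓘(ℝ, E) x →ₗ[ℝ] Module.End ℂ (S x) where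
  toFun v := B.chargeAdj x (A x v)
  map_add' v w := B.chargeAdj_eq fun φ ψ ↦ by simp [C_chargeAdj]
  map_smul' c v := B.chargeAdj_eq fun φ ψ ↦ by
    simp [← Complex.coe_smul, C_chargeAdj]

end SpinorBundle

/-! ### Connections -/

/-- The Levi-Civita connection on `M`: metric and without torsion. -/
structure IsLeviCivita
    (nablaM : CovariantDerivative 𝓘(ℝ, E) E (fun x : M ↦ TangentSpace 𝓘(ℝ, E) x)) : Prop where
  metric : ∀ (X Y : ∀ x : M, TangentSpace 𝓘(ℝ, E) x) (x : M) (v : TangentSpace 𝓘(ℝ, E) x),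
    MDifferentiableAt 𝓘(ℝ, E) (𝓘(ℝ, E).prod 𝓘(ℝ, E)) (fun y ↦ TotalSpace.mk' E y (X y)) x →
    MDifferentiableAt 𝓘(ℝ, E) (𝓘(ℝ, E).prod 𝓘(ℝ, E)) (fun y ↦ TotalSpace.mk' E y (Y y)) x →
    mfderiv 𝓘(ℝ, E) 𝓘(ℝ, ℝ) (fun y ↦ inner ℝ (X y) (Y y)) x v =
      inner ℝ (nablaM X x v) (Y x) + inner ℝ (X x) (nablaM Y x v)
  torsion_eq_zero : nablaM.torsion = 0

/-- Tangent spaces are finite dimensional (for the module structure of the tangent bundle). -/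
theorem finiteDimensional_tangentSpace (x : M) :
    FiniteDimensional ℝ (TangentSpace 𝓘(ℝ, E) x) :=
  inferInstanceAs (FiniteDimensional ℝ E)

/-- An orthonormal basis `e_1, …, e_{2 n}` of the tangent space at `x`. -/
def frame (x : M) : OrthonormalBasis (Fin (Module.finrank ℝ (TangentSpace 𝓘(ℝ, E) x))) ℝ
    (TangentSpace 𝓘(ℝ, E) x) :=
  haveI := finiteDimensional_tangentSpace (E := E) x
  stdOrthonormalBasis ℝ (TangentSpace 𝓘(ℝ, E) x)

variable [∀ x, IsTopologicalAddGroup (S x)] [∀ x, ContinuousSMul ℝ (S x)]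

/-- The connection `∇ + 𝒜` on `S` which differs from `∇` by the endomorphism valued one-form
`𝒜`. -/
def addForm (nablaS : CovariantDerivative 𝓘(ℝ, E) F S)
    (A : ∀ x : M, TangentSpace 𝓘(ℝ, E) x →ₗ[ℝ] Module.End ℂ (S x)) :
    CovariantDerivative 𝓘(ℝ, E) F S where
  toFun σ x :=
    haveI := finiteDimensional_tangentSpace (E := E) x
    nablaS σ x + LinearMap.toContinuousLinearMap
    ({ toFun := fun v ↦ A x v (σ x)
       map_add' := by simp
       map_smul' := by simp } : TangentSpace 𝓘(ℝ, E) x →ₗ[ℝ] S x)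
  isCovariantDerivativeOnUniv :=
    { add := fun hσ hσ' _ ↦ by
        ext v
        simp [nablaS.isCovariantDerivativeOnUniv.add hσ hσ']
        abel
      leibniz := fun hσ hg _ ↦ by
        ext v
        simp [nablaS.isCovariantDerivativeOnUniv.leibniz hσ hg]
        module }

theorem addForm_apply (nablaS : CovariantDerivative 𝓘(ℝ, E) F S)
    (A : ∀ x : M, TangentSpace 𝓘(ℝ, E) x →ₗ[ℝ] Module.End ℂ (S x))
    (σ : ∀ x, S x) (x : M) (v : TangentSpace 𝓘(ℝ, E) x) :
    addForm nablaS A σ x v = nablaS σ x v + A x v (σ x) := by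
  simp [addForm]

/-- The value `(D̂_v γ)(X) ξ ∈ S_x` for `v, X ∈ T_x M` and `ξ ∈ S_x`, where `D` is a connection on `S`
and `DC` its charge conjugate: `(D̂_v γ)(X) ξ = D_v (X ξ) - (∇_v X) ξ - X DC_v ξ`. The right hand side
is evaluated on a vector field and a section which extend `X` and `ξ`; see
`hatD_γ_apply` for the independence of the extensions. -/
def hatD_γ (B : SpinorBundle n E M F S)
    (nablaM : CovariantDerivative 𝓘(ℝ, E) E (fun x : M ↦ TangentSpace 𝓘(ℝ, E) x))
    (D DC : CovariantDerivative 𝓘(ℝ, E) F S) {x : M} (v X : TangentSpace 𝓘(ℝ, E) x) (ξ : S x) :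
    S x :=
  let X' : ∀ y : M, TangentSpace 𝓘(ℝ, E) y := FiberBundle.extend E X
  let ξ' : ∀ y : M, S y := FiberBundle.extend F ξ
  D (fun y ↦ B.γ y (X' y) (ξ' y)) x v - B.γ x (nablaM X' x v) ξ - B.γ x X (DC ξ' x v)

namespace SpinorBundle

variable (B : SpinorBundle n E M F S)

/-- The Levi-Civita connection on the spinor bundle: the (unique) complex linear connection for
which Clifford multiplication (with the Levi-Civita connection `nablaM` on `M`) and charge
conjugation are parallel. -/
structure IsSpinLeviCivita
    (nablaM : CovariantDerivative 𝓘(ℝ, E) E (fun x : M ↦ TangentSpace 𝓘(ℝ, E) x))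
    (nablaS : CovariantDerivative 𝓘(ℝ, E) F S) : Prop where
  map_smul : ∀ (c : ℂ) (σ : ∀ x, S x) (x : M) (v : TangentSpace 𝓘(ℝ, E) x),
    MDifferentiableAt 𝓘(ℝ, E) (𝓘(ℝ, E).prod 𝓘(ℝ, F)) (fun y ↦ TotalSpace.mk' F y (σ y)) x →
    nablaS (fun y ↦ c • σ y) x v = c • nablaS σ x v
  parallel_γ : ∀ (X : ∀ x : M, TangentSpace 𝓘(ℝ, E) x) (σ : ∀ x, S x) (x : M)
    (v : TangentSpace 𝓘(ℝ, E) x),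
    MDifferentiableAt 𝓘(ℝ, E) (𝓘(ℝ, E).prod 𝓘(ℝ, E)) (fun y ↦ TotalSpace.mk' E y (X y)) x →
    MDifferentiableAt 𝓘(ℝ, E) (𝓘(ℝ, E).prod 𝓘(ℝ, F)) (fun y ↦ TotalSpace.mk' F y (σ y)) x →
    nablaS (fun y ↦ B.γ y (X y) (σ y)) x v =
      B.γ x (nablaM X x v) (σ x) + B.γ x (X x) (nablaS σ x v)
  parallel_C : ∀ (φ ψ : ∀ x, S x) (x : M) (v : TangentSpace 𝓘(ℝ, E) x),
    MDifferentiableAt 𝓘(ℝ, E) (𝓘(ℝ, E).prod 𝓘(ℝ, F)) (fun y ↦ TotalSpace.mk' F y (φ y)) x →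
    MDifferentiableAt 𝓘(ℝ, E) (𝓘(ℝ, E).prod 𝓘(ℝ, F)) (fun y ↦ TotalSpace.mk' F y (ψ y)) x →
    mfderiv 𝓘(ℝ, E) 𝓘(ℝ, ℂ) (fun y ↦ B.C y (φ y) (ψ y)) x v =
      B.C x (nablaS φ x v) (ψ x) + B.C x (φ x) (nablaS ψ x v)

/-- The connection `D^C = ∇ - 𝒜^C` associated to `D = ∇ + 𝒜`. -/
def connC (nablaS : CovariantDerivative 𝓘(ℝ, E) F S)
    (A : ∀ x : M, TangentSpace 𝓘(ℝ, E) x →ₗ[ℝ] Module.End ℂ (S x)) :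
    CovariantDerivative 𝓘(ℝ, E) F S :=
  addForm nablaS (fun x ↦ -B.chargeAdjForm A x)

/-- `D ⊗ 1 + 1 ⊗ D^C` makes the charge conjugation parallel. -/
theorem connC_dual
    {nablaM : CovariantDerivative 𝓘(ℝ, E) E (fun x : M ↦ TangentSpace 𝓘(ℝ, E) x)}
    {nablaS : CovariantDerivative 𝓘(ℝ, E) F S} (hS : B.IsSpinLeviCivita nablaM nablaS)
    (A : ∀ x : M, TangentSpace 𝓘(ℝ, E) x →ₗ[ℝ] Module.End ℂ (S x))
    (φ ψ : ∀ x, S x) (x : M) (v : TangentSpace 𝓘(ℝ, E) x)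
    (hφ : MDifferentiableAt 𝓘(ℝ, E) (𝓘(ℝ, E).prod 𝓘(ℝ, F)) (fun y ↦ TotalSpace.mk' F y (φ y)) x)
    (hψ : MDifferentiableAt 𝓘(ℝ, E) (𝓘(ℝ, E).prod 𝓘(ℝ, F)) (fun y ↦ TotalSpace.mk' F y (ψ y)) x) :
    mfderiv 𝓘(ℝ, E) 𝓘(ℝ, ℂ) (fun y ↦ B.C y (φ y) (ψ y)) x v =
      B.C x (addForm nablaS A φ x v) (ψ x) + B.C x (φ x) (B.connC nablaS A ψ x v) := by
  have h : B.C x (A x v (φ x)) (ψ x) = B.C x (φ x) (B.chargeAdj x (A x v) (ψ x)) := by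
    have hΔ : ((B.Δ₀ : ℤ) : ℂ) * ((B.Δ₀ : ℤ) : ℂ) = 1 := by
      rcases Int.units_eq_one_or B.Δ₀ with h | h <;> simp [h]
    rw [B.symm_C x (φ x), C_chargeAdj, B.symm_C x (ψ x), ← mul_assoc, hΔ, one_mul]
  refine (hS.parallel_C φ ψ x v hφ hψ).trans ?_
  rw [connC, addForm_apply, addForm_apply]
  change B.C x (nablaS φ x v) (ψ x) + B.C x (φ x) (nablaS ψ x v) = _
  simp [chargeAdjForm, h]
  ring

/-- The value of `hatD_γ` does not depend on the extensions. -/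
theorem hatD_γ_apply [VectorBundle ℝ F S] [ContMDiffVectorBundle ∞ F S 𝓘(ℝ, E)]
    {nablaM : CovariantDerivative 𝓘(ℝ, E) E (fun x : M ↦ TangentSpace 𝓘(ℝ, E) x)}
    {nablaS : CovariantDerivative 𝓘(ℝ, E) F S} (hS : B.IsSpinLeviCivita nablaM nablaS)
    (A : ∀ x : M, TangentSpace 𝓘(ℝ, E) x →ₗ[ℝ] Module.End ℂ (S x))
    (X : ∀ x : M, TangentSpace 𝓘(ℝ, E) x) (ξ : ∀ x, S x) (x : M) (v : TangentSpace 𝓘(ℝ, E) x)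
    (hX : MDifferentiableAt 𝓘(ℝ, E) (𝓘(ℝ, E).prod 𝓘(ℝ, E)) (fun y ↦ TotalSpace.mk' E y (X y)) x)
    (hξ : MDifferentiableAt 𝓘(ℝ, E) (𝓘(ℝ, E).prod 𝓘(ℝ, F)) (fun y ↦ TotalSpace.mk' F y (ξ y)) x) :
    hatD_γ B nablaM (addForm nablaS A) (B.connC nablaS A) v (X x) (ξ x) =
      addForm nablaS A (fun y ↦ B.γ y (X y) (ξ y)) x v - B.γ x (nablaM X x v) (ξ x) -
        B.γ x (X x) (B.connC nablaS A ξ x v) := by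
  have key : ∀ (X : ∀ x : M, TangentSpace 𝓘(ℝ, E) x) (ξ : ∀ x, S x),
      MDifferentiableAt 𝓘(ℝ, E) (𝓘(ℝ, E).prod 𝓘(ℝ, E)) (fun y ↦ TotalSpace.mk' E y (X y)) x →
      MDifferentiableAt 𝓘(ℝ, E) (𝓘(ℝ, E).prod 𝓘(ℝ, F)) (fun y ↦ TotalSpace.mk' F y (ξ y)) x →
      addForm nablaS A (fun y ↦ B.γ y (X y) (ξ y)) x v - B.γ x (nablaM X x v) (ξ x) -
        B.γ x (X x) (B.connC nablaS A ξ x v) =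
      A x v (B.γ x (X x) (ξ x)) + B.γ x (X x) (B.chargeAdj x (A x v) (ξ x)) := by
    intro X ξ hX hξ
    rw [connC, addForm_apply, addForm_apply, hS.parallel_γ X ξ x v hX hξ]
    simp [chargeAdjForm]
    abel
  have hX' := key (FiberBundle.extend E (X x)) (FiberBundle.extend F (ξ x))
    (FiberBundle.mdifferentiableAt_extend 𝓘(ℝ, E) E (X x))
    (FiberBundle.mdifferentiableAt_extend 𝓘(ℝ, E) F (ξ x))
  rw [key X ξ hX hξ]
  simp only [FiberBundle.extend_apply_self] at hX'
  exact hX'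

/-- The torsion `𝒯` of the connection `D = ∇ + 𝒜` on `S`, twice the skew symmetrisation of `D̂ γ`:
the value `𝒯(X, Y) ξ = (D̂_X γ)(Y) ξ - (D̂_Y γ)(X) ξ`. -/
def torsion (nablaM : CovariantDerivative 𝓘(ℝ, E) E (fun x : M ↦ TangentSpace 𝓘(ℝ, E) x))
    (nablaS : CovariantDerivative 𝓘(ℝ, E) F S)
    (A : ∀ x : M, TangentSpace 𝓘(ℝ, E) x →ₗ[ℝ] Module.End ℂ (S x)) {x : M}
    (X Y : TangentSpace 𝓘(ℝ, E) x) (ξ : S x) : S x :=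
  hatD_γ B nablaM (addForm nablaS A) (B.connC nablaS A) X Y ξ -
    hatD_γ B nablaM (addForm nablaS A) (B.connC nablaS A) Y X ξ

/-- The value at `x` of
`𝔇(𝒯; φ, ψ) = (γ^μ φ ∧ 𝒯_{μν} ψ + γ^μ ψ ∧ 𝒯_{μν} φ) ⊗ e^ν ∈ Λ² S ⊗ TM`. -/
def frakD (T : ∀ x : M, TangentSpace 𝓘(ℝ, E) x → TangentSpace 𝓘(ℝ, E) x → S x → S x)
    (φ ψ : ∀ x, S x) (x : M) : (⋀[ℂ]^2 (S x)) ⊗[ℝ] TangentSpace 𝓘(ℝ, E) x :=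
  ∑ μ, ∑ ν,
    (exteriorPower.ιMulti ℂ 2
        ![B.γ x (frame x μ) (φ x), T x (frame x μ) (frame x ν) (ψ x)] +
      exteriorPower.ιMulti ℂ 2
        ![B.γ x (frame x μ) (ψ x), T x (frame x μ) (frame x ν) (φ x)]) ⊗ₜ[ℝ] frame x ν

/-- The potential `𝒜_μ = H_{μνκ} γ^{νκ}` of a (complex valued) three-form `H`. -/
def threeFormPotential (H : ∀ x : M, TangentSpace 𝓘(ℝ, E) x [⋀^Fin 3]→ₗ[ℝ] ℂ) (x : M) :
    TangentSpace 𝓘(ℝ, E) x →ₗ[ℝ] Module.End ℂ (S x) where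
  toFun v := ∑ ν, ∑ κ, H x ![v, frame x ν, frame x κ] •
    antisymmProd ![B.γ x (frame x ν), B.γ x (frame x κ)]
  map_add' v w := by
    simp only [← Finset.sum_add_distrib, ← add_smul]
    refine Finset.sum_congr rfl fun ν _ ↦ Finset.sum_congr rfl fun κ _ ↦ ?_
    congr 1
    simpa using (H x).map_vecCons_add ![frame x ν, frame x κ] v w
  map_smul' c v := by
    simp only [Finset.smul_sum, ← smul_assoc, RingHom.id_apply]
    refine Finset.sum_congr rfl fun ν _ ↦ Finset.sum_congr rfl fun κ _ ↦ ?_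
    congr 1
    simpa using (H x).map_vecCons_smul ![frame x ν, frame x κ] c v

/-! ### Pure spinors and the associated complex frames -/

/-- Clifford multiplication by complexified tangent vectors. -/
def γC (x : M) : (ℂ ⊗[ℝ] TangentSpace 𝓘(ℝ, E) x) →ₗ[ℂ] Module.End ℂ (S x) :=
  LinearMap.liftBaseChange ℂ (B.γ x)

/-- A spinor field is pure if at every point its null space `{X ∈ T_x M ⊗ ℂ | X η = 0}` has the
maximal dimension, namely `n`. -/
def IsPure (η : ∀ x, S x) : Prop :=
  ∀ x, Module.finrank ℂ (LinearMap.ker ((LinearMap.applyₗ (R := ℂ) (η x)).comp (B.γC x))) = n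

/-- The chirality operator `γ^*` with respect to the orthonormal frame `f_1, …, f_{2 n}`:
it is `γ^1 ⋯ γ^{2 n}` if `2 n ≡ 0 mod 4` and `i γ^1 ⋯ γ^{2 n}` if `2 n ≡ 2 mod 4`. -/
def gammaStar {x : M} (f : OrthonormalBasis (Fin (2 * n)) ℝ (TangentSpace 𝓘(ℝ, E) x)) :
    Module.End ℂ (S x) :=
  (if Even n then (1 : ℂ) else Complex.I) • (List.ofFn fun μ ↦ B.γ x (f μ)).prod

/-- An orthonormal frame `e_1, …, e_n, e_{n + 1}, …, e_{2 n}` (indexed by `Fin n ⊕ Fin n`) is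
adapted to the complex structure given by the pure spinor `η` if the vectors
`e_a - i e_{a + n}` lie in the null space of `η`. -/
def IsAdapted {x : M} (e : OrthonormalBasis (Fin n ⊕ Fin n) ℝ (TangentSpace 𝓘(ℝ, E) x))
    (η : S x) : Prop :=
  ∀ a : Fin n, B.γ x (e (Sum.inl a)) η - Complex.I • B.γ x (e (Sum.inr a)) η = 0

end SpinorBundle

/-- The complex frame of `T_x M ⊗ ℂ` associated to `e`: the unbarred vectors
`E_a = e_a + i e_{a + n}` (index `Sum.inl a`) and the barred ones `E_ā = e_a - i e_{a + n}`
(index `Sum.inr a`). -/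
def complexFrame {x : M} (e : Fin n ⊕ Fin n → TangentSpace 𝓘(ℝ, E) x) :
    Fin n ⊕ Fin n → ℂ ⊗[ℝ] TangentSpace 𝓘(ℝ, E) x
  | Sum.inl a => (1 : ℂ) ⊗ₜ[ℝ] e (Sum.inl a) + Complex.I ⊗ₜ[ℝ] e (Sum.inr a)
  | Sum.inr a => (1 : ℂ) ⊗ₜ[ℝ] e (Sum.inl a) - Complex.I ⊗ₜ[ℝ] e (Sum.inr a)

/-- The coefficients of the real frame in the complex one, `e_μ = ∑_i P_μ^i E_i`. -/
def frameCoeff (μ i : Fin n ⊕ Fin n) : ℂ :=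
  match μ, i with
  | Sum.inl b, Sum.inl a => if a = b then 1 / 2 else 0
  | Sum.inl b, Sum.inr a => if a = b then 1 / 2 else 0
  | Sum.inr b, Sum.inl a => if a = b then -Complex.I / 2 else 0
  | Sum.inr b, Sum.inr a => if a = b then Complex.I / 2 else 0

theorem sum_frameCoeff {x : M} (e : Fin n ⊕ Fin n → TangentSpace 𝓘(ℝ, E) x)
    (μ : Fin n ⊕ Fin n) :
    ∑ i, frameCoeff μ i • complexFrame e i = (1 : ℂ) ⊗ₜ[ℝ] e μ := by
  rcases μ with b | b
  · simp only [Fintype.sum_sum_type, frameCoeff, complexFrame, ite_smul, zero_smul,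
      Finset.sum_ite_eq', Finset.mem_univ, if_true]
    module
  · simp only [Fintype.sum_sum_type, frameCoeff, complexFrame, ite_smul, zero_smul,
      Finset.sum_ite_eq', Finset.mem_univ, if_true]
    have h : (1 : ℂ) ⊗ₜ[ℝ] e (Sum.inr b) =
        (-Complex.I) • ((Complex.I : ℂ) ⊗ₜ[ℝ] e (Sum.inr b)) := by
      rw [TensorProduct.smul_tmul', smul_eq_mul, neg_mul, Complex.I_mul_I, neg_neg]
    rw [h]
    module

/-- The components `H^{ijk}` of the three-form `H`, regarded as a three-vector by means of the
metric, in the complex frame associated to the orthonormal frame `e`: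
`∑ H(e_μ, e_ν, e_κ) e_μ ⊗ e_ν ⊗ e_κ = ∑ H^{ijk} E_i ⊗ E_j ⊗ E_k`. -/
def components {x : M} (e : OrthonormalBasis (Fin n ⊕ Fin n) ℝ (TangentSpace 𝓘(ℝ, E) x))
    (H : TangentSpace 𝓘(ℝ, E) x [⋀^Fin 3]→ₗ[ℝ] ℂ) (i j k : Fin n ⊕ Fin n) : ℂ :=
  ∑ μ, ∑ ν, ∑ κ, H ![e μ, e ν, e κ] * frameCoeff μ i * frameCoeff ν j * frameCoeff κ k

/-- The element
`H^{i a_{n-1} a_n} ε_{a_1 … a_n} γ^{a_1 … a_{n-2}} (1 - (-1)^n w γ^*) ⊗ E_i` of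
`End(S_x) ⊗ (T_x M ⊗ ℂ)`: the sum over the `a_*` is over the unbarred indices, i.e. over
`(a_1, …, a_n) = (σ 1, …, σ n)` for permutations `σ`, and the one over `i` is over all indices;
`γ^{a_1 … a_k}` is the antisymmetrised product of the `γ^a = γ(E_a)`. -/
def SpinorBundle.obstruction (B : SpinorBundle n E M F S) (hn : 2 ≤ n) {x : M}
    (e : OrthonormalBasis (Fin n ⊕ Fin n) ℝ (TangentSpace 𝓘(ℝ, E) x))
    (H : TangentSpace 𝓘(ℝ, E) x [⋀^Fin 3]→ₗ[ℝ] ℂ) (gammaStar : Module.End ℂ (S x)) (w : ℂ) :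
    Module.End ℂ (S x) ⊗[ℂ] (ℂ ⊗[ℝ] TangentSpace 𝓘(ℝ, E) x) :=
  ∑ i, ∑ σ : Equiv.Perm (Fin n),
    ((components e H i (Sum.inl (σ ⟨n - 2, by omega⟩)) (Sum.inl (σ ⟨n - 1, by omega⟩)) *
        ((Equiv.Perm.sign σ : ℤ) : ℂ)) •
      (antisymmProd (fun j : Fin (n - 2) ↦
          B.γC x (complexFrame e (Sum.inl (σ (Fin.castLE (Nat.sub_le n 2) j))))) *
        (1 - ((-1) ^ n * w) • gammaStar))) ⊗ₜ[ℂ] complexFrame e i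

end SpinorTorsion
end

/-!
Since Clifford multiplication is parallel and each `γ^{νκ}` is minus its own charge adjoint,
`𝒯(X, Y) = [𝒜_X, Y] - [𝒜_Y, X] = 8 F(X, Y, e_κ) γ^κ`. Hence `𝔇(𝒯; η, η)` contracts two indices of
`F` with `γ^μ η ∧ γ^κ η`, and only the components `F^{i a b}` with `a`, `b` unbarred contribute,
because the barred gammas annihilate `η`.

The obstruction forces exactly these components to vanish. Its `i`-th component is
`Θ (1 - (-1)^n w γ^*)`, where `Θ` has degree `n - 2` in the anticommuting unbarred gammas. Thus
`Θ ψ = (-1)^n w Θ γ^* ψ` for every `ψ`. Apply this to `γ^c γ^d η`, and also to `γ^d η` followed by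
`γ^c`: these two spinors have opposite chirality, whereas `γ^c` commutes with `Θ` up to sign, so
`Θ γ^c γ^d η` equals its own negative. In `Θ γ^c γ^d η` only the permutations with
`{a_{n-1}, a_n} = {c, d}` survive, and each contributes `F^{i c d} γ^1 ⋯ γ^n η`. Finally
`γ^1 ⋯ γ^n η ≠ 0`, since the barred gammas strip this product down to a nonzero multiple of `η`.
-/

noncomputable section

namespace SpinorTorsion

section Anticommuting

variable {R A : Type*} [CommRing R] [Ring A] [Algebra R A]

theorem mul_list_prod_of_anticomm {a : A} {l : List A} (h : ∀ b ∈ l, a * b = -(b * a)) :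
    a * l.prod = (-1 : R) ^ l.length • (l.prod * a) := by
  induction l with
  | nil => simp
  | cons b l ih =>
    have ih := ih fun c hc ↦ h c (List.mem_cons_of_mem b hc)
    rw [List.prod_cons, ← mul_assoc, h b List.mem_cons_self, neg_mul, mul_assoc, ih,
      mul_smul_comm, List.length_cons, pow_succ, mul_neg_one, neg_smul, mul_assoc]

theorem mul_list_prod_map_of_mem {ι : Type*} {g : ι → A}
    (hg : ∀ a b, a ≠ b → g a * g b = -(g b * g a)) {l : List ι} (hl : l.Nodup) {a : ι}
    (ha : a ∈ l) :
    g a * (l.map g).prod = (-1 : R) ^ (l.length + 1) • ((l.map g).prod * g a) := by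
  induction l with
  | nil => simp at ha
  | cons b l ih =>
    obtain ⟨hb, hl⟩ := List.nodup_cons.1 hl
    rw [List.map_cons, List.prod_cons, List.length_cons]
    by_cases hab : a = b
    · subst hab
      have hpast : g a * (l.map g).prod = (-1 : R) ^ l.length • ((l.map g).prod * g a) := by
        simpa using mul_list_prod_of_anticomm (R := R) (a := g a) (l := l.map g) (by grind)
      rw [mul_assoc, hpast, mul_smul_comm, pow_succ, pow_succ, mul_assoc, neg_mul_neg, one_mul,
        mul_one]
    · rw [← mul_assoc, hg a b hab, neg_mul, mul_assoc, ih hl (by grind), mul_smul_comm,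
        pow_succ _ (l.length + 1), mul_neg_one, neg_smul, mul_assoc]

theorem list_prod_map_apply_ne_zero {V ι : Type*} [AddCommGroup V] [Module R V] [DecidableEq ι]
    {g h : ι → Module.End R V} {c : R} (hc : IsUnit c)
    (hgh : ∀ a b, h a * g b + g b * h a = if a = b then c • 1 else 0) {η : V} (hη : η ≠ 0)
    (hh : ∀ a, h a η = 0) {l : List ι} (hl : l.Nodup) : (l.map g).prod η ≠ 0 := by
  induction l with
  | nil => simpa
  | cons a l ih =>
    obtain ⟨ha, hl⟩ := List.nodup_cons.1 hl
    have hz : h a ((l.map g).prod η) = 0 := by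
      have hpast := mul_list_prod_of_anticomm (R := R) (a := h a) (l := l.map g) <| by
        simp only [List.mem_map, forall_exists_index, and_imp, forall_apply_eq_imp_iff₂]
        exact fun b hb ↦ eq_neg_of_add_eq_zero_left (by rw [hgh, if_neg (by grind)])
      rw [← Module.End.mul_apply, hpast]
      simp [hh]
    intro h0
    refine ih hl (hc.smul_eq_zero.1 ?_)
    calc c • (l.map g).prod η
        = h a (g a ((l.map g).prod η)) + g a (h a ((l.map g).prod η)) := by
          simpa using congr($((hgh a a).symm) ((l.map g).prod η))
      _ = 0 := by
          rw [List.map_cons, List.prod_cons, Module.End.mul_apply] at h0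
          rw [h0, hz, map_zero, map_zero, add_zero]

end Anticommuting

section Permutations

theorem exists_perm_apply_eq_and_apply_eq {ι : Type*} {p q c d : ι} (hpq : p ≠ q) (hcd : c ≠ d) :
    ∃ σ : Equiv.Perm ι, σ p = c ∧ σ q = d :=
  MulAction.is_two_pretransitive_iff.1 (Equiv.Perm.isMultiplyPretransitive ι 2) hpq hcd

variable {ι : Type*} [DecidableEq ι]

theorem perm_eq_or_eq_mul_swap {σ τ : Equiv.Perm ι} {p q : ι}
    (h : ∀ j, j ≠ p → j ≠ q → τ j = σ j) : τ = σ ∨ τ = σ * Equiv.swap p q := by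
  have hmaps (j : ι) (hj : j = p ∨ j = q) : τ j = σ p ∨ τ j = σ q := by
    simp only [← Equiv.symm_apply_eq]
    by_contra! hne
    have := τ.injective ((h _ hne.1 hne.2).trans (σ.apply_symm_apply (τ j)))
    grind
  have hinj : τ p = τ q ↔ p = q := τ.injective.eq_iff
  have hp := hmaps p (.inl rfl)
  have hq := hmaps q (.inr rfl)
  by_cases hpp : τ p = σ p
  · exact .inl (Equiv.ext fun j ↦ by by_cases j = p <;> by_cases j = q <;> grind)
  · exact .inr (Equiv.ext fun j ↦ by grind [Equiv.Perm.mul_apply])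

variable [Fintype ι] {R N Q : Type*} [CommRing R] [AddCommGroup N] [Module R N] [AddCommGroup Q]
  [Module R Q] (Φ : N [⋀^ι]→ₗ[R] Q) (v : ι → N)

theorem sign_smul_map_comp_perm (σ : Equiv.Perm ι) :
    ((Equiv.Perm.sign σ : ℤ) : R) • Φ (v ∘ σ) = Φ v := by
  rw [Int.cast_smul_eq_zsmul, ← Units.smul_def]
  exact (Φ.map_congr_perm v σ).symm

theorem sign_smul_map_comp_perm_of_agree {G : ι → ι → R} (hG : ∀ a b, G a b = -G b a)
    {p q : ι} (hpq : p ≠ q) {σ τ : Equiv.Perm ι} (h : ∀ j, j ≠ p → j ≠ q → τ j = σ j) :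
    (G (σ p) (σ q) * ((Equiv.Perm.sign σ : ℤ) : R)) • Φ (v ∘ τ) = G (τ p) (τ q) • Φ v := by
  rcases perm_eq_or_eq_mul_swap h with rfl | rfl
  · rw [mul_smul, sign_smul_map_comp_perm]
  · rw [← sign_smul_map_comp_perm Φ v (σ * Equiv.swap p q), Equiv.Perm.sign_mul,
      Equiv.Perm.sign_swap hpq, hG]
    simp [mul_smul]

theorem eq_zero_of_sum_perm_smul_map_update {K N Q : Type*} [Field K] [CharZero K]
    [AddCommGroup N] [Module K N] [AddCommGroup Q] [Module K Q] {Φ : N [⋀^ι]→ₗ[K] Q} {v : ι → N}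
    (hΦ : Φ v ≠ 0) {G : ι → ι → K} (hG : ∀ a b, G a b = -G b a) {p q : ι} (hpq : p ≠ q) {c d : ι}
    (h : ∑ σ : Equiv.Perm ι, (G (σ p) (σ q) * ((Equiv.Perm.sign σ : ℤ) : K)) •
      Φ (v ∘ Function.update (Function.update σ p c) q d) = 0) : G c d = 0 := by
  classical
  rcases eq_or_ne c d with rfl | hcd
  · exact self_eq_neg.1 (hG c c)
  let u (σ : Equiv.Perm ι) : ι → ι := Function.update (Function.update σ p c) q d
  have hup σ : u σ p = c := by simp [u, hpq]
  have huq σ : u σ q = d := by simp [u]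
  have hterm (σ : Equiv.Perm ι) :
      (G (σ p) (σ q) * ((Equiv.Perm.sign σ : ℤ) : K)) • Φ (v ∘ u σ) =
        if (u σ).Injective then G c d • Φ v else 0 := by
    split_ifs with hu
    · let τ := Equiv.ofBijective (u σ) (Finite.injective_iff_bijective.1 hu)
      have hagree j (hjp : j ≠ p) (hjq : j ≠ q) : τ j = σ j := by simp [τ, u, hjp, hjq]
      rw [← hup σ, ← huq σ]
      exact sign_smul_map_comp_perm_of_agree Φ v hG hpq hagree
    · rw [Φ.map_eq_zero_of_not_injective _ fun hvu ↦ hu hvu.of_comp, smul_zero]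
  obtain ⟨σ, hσp, hσq⟩ := exists_perm_apply_eq_and_apply_eq hpq hcd
  have hσ : (u σ).Injective := by
    simp only [u, ← hσp, ← hσq, Function.update_eq_self]
    exact σ.injective
  have hcard : (Finset.univ.filter fun σ ↦ (u σ).Injective).card ≠ 0 :=
    Finset.card_ne_zero_of_mem (Finset.mem_filter.2 ⟨Finset.mem_univ σ, hσ⟩)
  rw [Finset.sum_congr rfl fun σ _ ↦ hterm σ, ← Finset.sum_filter, Finset.sum_const,
    ← Nat.cast_smul_eq_nsmul K, smul_eq_zero, smul_eq_zero, Nat.cast_eq_zero] at h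
  exact (h.resolve_left hcard).resolve_right hΦ

end Permutations

section AlternatingProduct

variable {R N A : Type*} [CommRing R] [AddCommGroup N] [Module R N] [Ring A] [Algebra R A]

/-- The product `f (v 0) ⋯ f (v (k - 1))`, which is alternating in `v` because `f` takes values in
elements of square zero: it is the image of `v 0 ∧ ⋯ ∧ v (k - 1)` under the algebra homomorphism
from the exterior algebra determined by `f`. -/
def altProd (f : N →ₗ[R] A) (hf : ∀ v, f v * f v = 0) (k : ℕ) : N [⋀^Fin k]→ₗ[R] A :=
  (ExteriorAlgebra.lift R ⟨f, hf⟩).toLinearMap.compAlternatingMap (ExteriorAlgebra.ιMulti R k)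

theorem altProd_apply (f : N →ₗ[R] A) (hf : ∀ v, f v * f v = 0) {k : ℕ} (v : Fin k → N) :
    altProd f hf k v = (List.ofFn fun j ↦ f (v j)).prod := by
  simp [altProd, ExteriorAlgebra.ιMulti_apply, map_list_prod, List.map_ofFn, Function.comp_def]

theorem linearCombination_mul_self {ι : Type*} [Fintype ι] {g : ι → A}
    (hsq : ∀ a, g a * g a = 0) (hg : ∀ a b, g a * g b = -(g b * g a)) (v : ι → R) :
    Fintype.linearCombination R g v * Fintype.linearCombination R g v = 0 := by
  simp only [Fintype.linearCombination_apply, Finset.sum_mul_sum, smul_mul_smul_comm,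
    ← Finset.sum_product']
  refine Finset.sum_involution (fun i _ ↦ i.swap) ?_ ?_ (by simp) (by simp)
  · rintro ⟨a, b⟩ -
    rw [Prod.fst_swap, Prod.snd_swap, hg b a, mul_comm (v b), smul_neg, add_neg_cancel]
  · rintro ⟨a, b⟩ - hne heq
    obtain rfl : b = a := congrArg Prod.fst heq
    exact hne (by rw [hsq, smul_zero])

end AlternatingProduct

section AnticommutingEndomorphisms

variable {K V : Type*} [Field K] [CharZero K] [AddCommGroup V] [Module K V]

theorem exists_alternatingMap_eq_list_prod {ι : Type*} [Finite ι] [DecidableEq ι]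
    {g : ι → Module.End K V} (hg : ∀ a b, g a * g b = -(g b * g a)) (k : ℕ) :
    ∃ Φ : (ι → K) [⋀^Fin k]→ₗ[K] Module.End K V, ∀ u : Fin k → ι,
      Φ ((fun a ↦ Pi.single a 1) ∘ u) = (List.ofFn fun j ↦ g (u j)).prod := by
  have := Fintype.ofFinite ι
  have : IsAddTorsionFree (Module.End K V) := .of_isTorsionFree K _
  have hsq (a) : g a * g a = 0 := self_eq_neg.1 (hg a a)
  refine ⟨altProd (Fintype.linearCombination K g) (linearCombination_mul_self hsq hg) k,
    fun u ↦ ?_⟩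
  simp [altProd_apply]

theorem antisymmProd_eq_list_prod {V : Type*} [AddCommGroup V] [Module ℂ V] {k : ℕ}
    {A : Fin k → Module.End ℂ V} (hA : ∀ i j, A i * A j = -(A j * A i)) :
    antisymmProd A = (List.ofFn A).prod := by
  obtain ⟨Φ, hΦ⟩ := exists_alternatingMap_eq_list_prod hA k
  have hperm (σ : Equiv.Perm (Fin k)) : ((Equiv.Perm.sign σ : ℤ) : ℂ) •
      (List.ofFn fun j ↦ A (σ j)).prod = (List.ofFn A).prod := by
    rw [← hΦ, sign_smul_map_comp_perm]
    exact hΦ id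
  simp only [antisymmProd, hperm, Finset.sum_const, Finset.card_univ, Fintype.card_perm,
    Fintype.card_fin]
  rw [← Nat.cast_smul_eq_nsmul ℂ, smul_smul,
    inv_mul_cancel₀ (Nat.cast_ne_zero.2 k.factorial_ne_zero), one_smul]

theorem eq_zero_of_sum_perm_smul_list_prod_apply {k : ℕ} {g : Fin k → Module.End K V}
    (hg : ∀ a b, g a * g b = -(g b * g a)) {η : V} (hη : (List.ofFn g).prod η ≠ 0)
    {G : Fin k → Fin k → K} (hG : ∀ a b, G a b = -G b a) {p q : Fin k} (hpq : p ≠ q)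
    {c d : Fin k}
    (h : ∑ σ : Equiv.Perm (Fin k), (G (σ p) (σ q) * ((Equiv.Perm.sign σ : ℤ) : K)) •
      (List.ofFn fun j ↦ g (Function.update (Function.update σ p c) q d j)).prod η = 0) :
    G c d = 0 := by
  obtain ⟨Φ, hΦ⟩ := exists_alternatingMap_eq_list_prod hg k
  refine eq_zero_of_sum_perm_smul_map_update
    (Φ := (LinearMap.applyₗ (R := K) η).compAlternatingMap Φ) (v := fun a ↦ Pi.single a 1)
    (fun h0 ↦ hη ?_) hG hpq (c := c) (d := d) ?_
  · exact congr($((hΦ id).symm) η).trans h0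
  · simpa [hΦ] using h

end AnticommutingEndomorphisms

section Chirality

theorem apply_apply_eq_zero_of_mul_one_sub_smul_eq_zero {K V : Type*} [Field K] [NeZero (2 : K)]
    [AddCommGroup V] [Module K V] {Θ Γ a b : Module.End K V} {ε w : K} {η : V} (hε : ε ≠ 0)
    (hΘ : Θ * (1 - (ε * w) • Γ) = 0) (ha : a * Θ = ε • (Θ * a)) (hΓa : Γ * a = -(a * Γ))
    (hΓb : Γ * b = -(b * Γ)) (hη : Γ η = w • η) : Θ (a (b η)) = 0 := by
  have hΘ' (v : V) : Θ v = (ε * w) • Θ (Γ v) := by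
    simpa [sub_eq_zero] using congr($hΘ v)
  have ha' (v : V) : a (Θ v) = ε • Θ (a v) := congr($ha v)
  have hb : Γ (b η) = -w • b η := by simpa [hη] using congr($hΓb η)
  have hab : Γ (a (b η)) = w • a (b η) := by simpa [hb] using congr($hΓa (b η))
  have hminus : Θ (a (b η)) = (ε * w ^ 2) • Θ (a (b η)) := by
    conv_lhs => rw [hΘ', hab, map_smul, smul_smul]
    congr 1
    ring
  have hplus : Θ (a (b η)) = -(ε * w ^ 2) • Θ (a (b η)) := by
    refine smul_right_injective V hε ?_
    calc ε • Θ (a (b η)) = a (Θ (b η)) := (ha' _).symm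
      _ = -(ε * w ^ 2) • a (Θ (b η)) := by
          conv_lhs => rw [hΘ', hb, map_smul, map_smul, map_smul, smul_smul]
          congr 1
          ring
      _ = ε • -(ε * w ^ 2) • Θ (a (b η)) := by rw [ha', smul_comm]
  have htwo : (2 : K) • Θ (a (b η)) = 0 := by
    rw [two_smul]
    nth_rw 1 [hminus]
    nth_rw 2 [hplus]
    rw [neg_smul, add_neg_cancel]
  exact (smul_eq_zero.1 htwo).resolve_left two_ne_zero

variable {V : Type*} [AddCommGroup V] [Module ℂ V]

theorem eq_zero_of_sum_perm_smul_antisymmProd_mul_eq_zero {m : ℕ}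
    {g : Fin (m + 2) → Module.End ℂ V} (hg : ∀ a b, g a * g b = -(g b * g a))
    {Γ : Module.End ℂ V} (hΓ : ∀ a, Γ * g a = -(g a * Γ)) {w : ℂ} {η : V} (hw : Γ η = w • η)
    (hη : (List.ofFn g).prod η ≠ 0) {G : Fin (m + 2) → Fin (m + 2) → ℂ}
    (hG : ∀ a b, G a b = -G b a)
    (h : ∑ σ : Equiv.Perm (Fin (m + 2)),
      (G (σ (Fin.last m).castSucc) (σ (Fin.last (m + 1))) * ((Equiv.Perm.sign σ : ℤ) : ℂ)) •
        (antisymmProd (fun j : Fin m ↦ g (σ j.castSucc.castSucc)) *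
          (1 - ((-1) ^ m * w) • Γ)) = 0) (c d : Fin (m + 2)) :
    G c d = 0 := by
  let Θ : Module.End ℂ V := ∑ σ : Equiv.Perm (Fin (m + 2)),
    (G (σ (Fin.last m).castSucc) (σ (Fin.last (m + 1))) * ((Equiv.Perm.sign σ : ℤ) : ℂ)) •
      (List.ofFn fun j : Fin m ↦ g (σ j.castSucc.castSucc)).prod
  have hΘ : Θ * (1 - ((-1) ^ m * w) • Γ) = 0 := by
    rw [← h, Finset.sum_mul]
    refine Finset.sum_congr rfl fun σ _ ↦ ?_
    rw [antisymmProd_eq_list_prod fun i j ↦ hg _ _, smul_mul_assoc]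
  have hcomm (a) : g a * Θ = (-1 : ℂ) ^ m • (Θ * g a) := by
    simp only [Θ, Finset.mul_sum, Finset.sum_mul, Finset.smul_sum]
    refine Finset.sum_congr rfl fun σ _ ↦ ?_
    have := mul_list_prod_of_anticomm (R := ℂ) (a := g a)
      (l := List.ofFn fun j : Fin m ↦ g (σ j.castSucc.castSucc)) (by simp [List.mem_ofFn, hg a])
    rw [mul_smul_comm, this, List.length_ofFn, smul_comm, smul_mul_assoc]
  have hkill := apply_apply_eq_zero_of_mul_one_sub_smul_eq_zero (by simp) hΘ (hcomm c) (hΓ c)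
    (hΓ d) hw
  refine eq_zero_of_sum_perm_smul_list_prod_apply hg hη hG (Fin.castSucc_lt_last (Fin.last m)).ne ?_
  simpa [-List.ofFn_succ, Θ, List.ofFn_succ', Fin.castSucc_ne_last] using hkill

end Chirality

section AlternatingMaps

variable {R N Q : Type*} [CommRing R] [AddCommGroup N] [Module R N] [AddCommGroup Q] [Module R Q]

theorem map_vecCons_vecCons_swap {k : ℕ} (H : N [⋀^Fin (k + 2)]→ₗ[R] Q) (x y : N)
    (v : Fin k → N) :
    H (Matrix.vecCons y (Matrix.vecCons x v)) = -H (Matrix.vecCons x (Matrix.vecCons y v)) := by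
  rw [← H.map_swap (Matrix.vecCons x (Matrix.vecCons y v)) (Fin.succ_ne_zero 0).symm]
  congr 1
  ext i
  refine Fin.cases ?_ (fun i ↦ Fin.cases ?_ (fun i ↦ ?_) i) i
  · simp
  · simp
  · rw [Function.comp_apply, Equiv.swap_apply_of_ne_of_ne (by simp) (by simp [Fin.ext_iff])]
    simp

/-- An alternating map of degree two as a bilinear map. -/
def bilinOfAlternating (α : N [⋀^Fin 2]→ₗ[R] Q) : N →ₗ[R] N →ₗ[R] Q :=
  LinearMap.mk₂ R (fun u v ↦ α ![u, v])
    (fun u u' v ↦ α.map_vecCons_add ![v] u u')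
    (fun c u v ↦ α.map_vecCons_smul ![v] c u)
    (fun u v v' ↦ (α.curryLeft u).map_vecCons_add ![] v v')
    (fun c u v ↦ (α.curryLeft u).map_vecCons_smul ![] c v)

@[simp]
theorem bilinOfAlternating_apply (α : N [⋀^Fin 2]→ₗ[R] Q) (u v : N) :
    bilinOfAlternating α u v = α ![u, v] := rfl

end AlternatingMaps

section OrthonormalBases

variable {W : Type*} [NormedAddCommGroup W] [InnerProductSpace ℝ W] {ι κ : Type*} [Fintype ι]
  [Fintype κ]

theorem sum_orthonormalBasis_eq {N : Type*} [AddCommGroup N] [Module ℝ N]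
    (b : W →ₗ[ℝ] W →ₗ[ℝ] N) (f : OrthonormalBasis ι ℝ W) (e : OrthonormalBasis κ ℝ W) :
    ∑ i, b (f i) (f i) = ∑ j, b (e j) (e j) := by
  have := f.toBasis.finiteDimensional_of_finite
  have h := (InnerProductSpace.canonicalCovariantTensor_eq_sum W f).symm.trans
    (InnerProductSpace.canonicalCovariantTensor_eq_sum W e)
  simpa using congr(TensorProduct.lift b $h)

theorem sum_sum_smul_orthonormalBasis_eq {N : Type*} [AddCommGroup N] [Module ℂ N]
    (α : W →ₗ[ℝ] W →ₗ[ℝ] ℂ) (ψ : W →ₗ[ℝ] W →ₗ[ℝ] N) (f : OrthonormalBasis ι ℝ W)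
    (e : OrthonormalBasis κ ℝ W) :
    ∑ i, ∑ j, α (f i) (f j) • ψ (f i) (f j) = ∑ i, ∑ j, α (e i) (e j) • ψ (e i) (e j) := by
  let Q : W →ₗ[ℝ] W →ₗ[ℝ] W →ₗ[ℝ] W →ₗ[ℝ] N := LinearMap.mk₂ ℝ
    (fun u u' ↦ ((LinearMap.lsmul ℂ N).restrictScalars₁₂ ℝ ℝ).compl₁₂ (α u) (ψ u'))
    (fun u v u' ↦ by ext; simp) (fun c u u' ↦ by ext; simp [mul_smul])
    (fun u u' v' ↦ by ext; simp) (fun c u u' ↦ by ext; simp [smul_comm c])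
  calc ∑ i, ∑ j, Q (f i) (f i) (f j) (f j)
      = ∑ j, (∑ i, Q (f i) (f i)) (f j) (f j) := by
        rw [Finset.sum_comm]
        simp
    _ = ∑ j, (∑ i, Q (e i) (e i)) (e j) (e j) := by
        rw [sum_orthonormalBasis_eq Q f e, sum_orthonormalBasis_eq _ f e]
    _ = ∑ i, ∑ j, Q (e i) (e i) (e j) (e j) := by
        rw [Finset.sum_comm]
        simp

end OrthonormalBases

section Clifford

variable {V : Type*} [AddCommGroup V] [Module ℂ V]

theorem antisymmProd_two (a b : Module.End ℂ V) :
    antisymmProd ![a, b] = (1 / 2 : ℂ) • (a * b - b * a) := by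
  have h : (Finset.univ : Finset (Equiv.Perm (Fin 2))) = {1, Equiv.swap 0 1} := by decide
  rw [antisymmProd, h, Finset.sum_pair (by decide)]
  simp [sub_eq_add_neg]

theorem antisymmProd_two_mul_sub_mul {a b c : Module.End ℂ V} {s t : ℂ}
    (hac : a * c + c * a = s • 1) (hbc : b * c + c * b = t • 1) :
    antisymmProd ![a, b] * c - c * antisymmProd ![a, b] = t • a - s • b := by
  have hab : a * b * c - c * (a * b) = t • a - s • b := by
    calc a * b * c - c * (a * b) = a * (b * c + c * b) - (a * c + c * a) * b := by noncomm_ring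
      _ = t • a - s • b := by simp [hac, hbc]
  have hba : b * a * c - c * (b * a) = s • b - t • a := by
    calc b * a * c - c * (b * a) = b * (a * c + c * a) - (b * c + c * b) * a := by noncomm_ring
      _ = s • b - t • a := by simp [hac, hbc]
  rw [antisymmProd_two, smul_mul_assoc, mul_smul_comm, sub_mul, mul_sub]
  linear_combination (norm := module) (1 / 2 : ℂ) • hab - (1 / 2 : ℂ) • hba

variable {W : Type*} [NormedAddCommGroup W] [InnerProductSpace ℝ W] {ι : Type*} [Fintype ι]
  {γ : W →ₗ[ℝ] Module.End ℂ V}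

theorem sum_smul_antisymmProd_mul_sub_mul
    (hγ : ∀ X Y, γ X * γ Y + γ Y * γ X = (-2 * inner ℝ X Y : ℝ) • (1 : Module.End ℂ V))
    (f : OrthonormalBasis ι ℝ W) (α : W [⋀^Fin 2]→ₗ[ℝ] ℂ) (Y : W) :
    (∑ i, ∑ j, α ![f i, f j] • antisymmProd ![γ (f i), γ (f j)]) * γ Y -
      γ Y * (∑ i, ∑ j, α ![f i, f j] • antisymmProd ![γ (f i), γ (f j)]) =
    (4 : ℂ) • ∑ j, α ![Y, f j] • γ (f j) := by
  have hcomm (u v : W) : antisymmProd ![γ u, γ v] * γ Y - γ Y * antisymmProd ![γ u, γ v] =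
      (2 * inner ℝ u Y : ℂ) • γ v - (2 * inner ℝ v Y : ℂ) • γ u := by
    have hγ' (u : W) : γ u * γ Y + γ Y * γ u = (-2 * inner ℝ u Y : ℂ) • 1 := by
      rw [hγ, ← Complex.coe_smul]
      push_cast
      rfl
    rw [antisymmProd_two_mul_sub_mul (hγ' u) (hγ' v)]
    module
  have hsum (Z : W) : ∑ i, (inner ℝ (f i) Y : ℂ) * α ![f i, Z] = α ![Y, Z] := by
    simpa using congr(bilinOfAlternating α $(f.sum_repr' Y) Z)
  calc _ = ∑ i, ∑ j, α ![f i, f j] • ((2 * inner ℝ (f i) Y : ℂ) • γ (f j) -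
        (2 * inner ℝ (f j) Y : ℂ) • γ (f i)) := by
        simp only [Finset.sum_mul, Finset.mul_sum, ← Finset.sum_sub_distrib, smul_mul_assoc,
          mul_smul_comm, ← smul_sub, hcomm]
    _ = ∑ i, ∑ j, ((4 * ((inner ℝ (f i) Y : ℂ) * α ![f i, f j])) • γ (f j)) := by
        simp only [smul_sub, Finset.sum_sub_distrib]
        nth_rw 2 [Finset.sum_comm]
        simp only [← Finset.sum_sub_distrib]
        refine Finset.sum_congr rfl fun i _ ↦ Finset.sum_congr rfl fun j _ ↦ ?_
        rw [map_vecCons_vecCons_swap α (f i) (f j)]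
        module
    _ = _ := by
        rw [Finset.sum_comm]
        simp only [← hsum, Finset.sum_smul, Finset.smul_sum, smul_smul]

end Clifford

section ComplexFrame

variable {n : ℕ}

theorem eq_zero_of_sum_mul_frameCoeff_eq_zero {K : Fin n ⊕ Fin n → ℂ}
    (h : ∀ i, ∑ μ, K μ * frameCoeff μ i = 0) : K = 0 := by
  have hunbarred (a : Fin n) : K (.inl a) - Complex.I * K (.inr a) = 0 := by
    have := h (.inl a)
    simp only [Fintype.sum_sum_type, frameCoeff, mul_ite, mul_zero, Finset.sum_ite_eq,
      Finset.mem_univ, if_true] at this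
    linear_combination 2 * this
  have hbarred (a : Fin n) : K (.inl a) + Complex.I * K (.inr a) = 0 := by
    have := h (.inr a)
    simp only [Fintype.sum_sum_type, frameCoeff, mul_ite, mul_zero, Finset.sum_ite_eq,
      Finset.mem_univ, if_true] at this
    linear_combination 2 * this
  funext μ
  rcases μ with a | a <;> rw [Pi.zero_apply]
  · linear_combination (hunbarred a + hbarred a) / 2
  · linear_combination (Complex.I / 2) * (hunbarred a - hbarred a) + K (.inr a) * Complex.I_mul_I

/-- The component `α^{jk}` of the two-form `α`, regarded as a two-vector by means of the metric, in
the complex frame associated to the orthonormal frame `e`. -/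
def twoFormComponent {W : Type*} [AddCommGroup W] [Module ℝ W] (e : Fin n ⊕ Fin n → W)
    (j k : Fin n ⊕ Fin n) : (W [⋀^Fin 2]→ₗ[ℝ] ℂ) →ₗ[ℝ] ℂ where
  toFun α := ∑ ν, ∑ κ, α ![e ν, e κ] * frameCoeff ν j * frameCoeff κ k
  map_add' α β := by simp [add_mul, Finset.sum_add_distrib]
  map_smul' c α := by
    simp only [AlternatingMap.smul_apply, smul_mul_assoc, Finset.smul_sum, RingHom.id_apply]

theorem twoFormComponent_apply {W : Type*} [AddCommGroup W] [Module ℝ W] (e : Fin n ⊕ Fin n → W)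
    (j k : Fin n ⊕ Fin n) (α : W [⋀^Fin 2]→ₗ[ℝ] ℂ) :
    twoFormComponent e j k α = ∑ ν, ∑ κ, α ![e ν, e κ] * frameCoeff ν j * frameCoeff κ k := rfl

variable {E : Type*} [NormedAddCommGroup E] [NormedSpace ℝ E]
  {M : Type*} [TopologicalSpace M] [ChartedSpace E M]
  [RiemannianBundle (fun x : M ↦ TangentSpace 𝓘(ℝ, E) x)] {x : M}
  (e : OrthonormalBasis (Fin n ⊕ Fin n) ℝ (TangentSpace 𝓘(ℝ, E) x))

theorem top_le_span_complexFrame [FiniteDimensional ℝ E] [IsManifold 𝓘(ℝ, E) ∞ M] :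
    ⊤ ≤ Submodule.span ℂ (Set.range (complexFrame e)) := by
  rw [← (Algebra.TensorProduct.basis ℂ e.toBasis).span_eq, Submodule.span_le]
  rintro _ ⟨μ, rfl⟩
  rw [Algebra.TensorProduct.basis_apply, e.coe_toBasis, ← sum_frameCoeff]
  exact Submodule.sum_mem _ fun i _ ↦
    Submodule.smul_mem _ _ (Submodule.subset_span (Set.mem_range_self i))

theorem linearIndependent_complexFrame [FiniteDimensional ℝ E] [IsManifold 𝓘(ℝ, E) ∞ M] :
    LinearIndependent ℂ (complexFrame e) :=
  linearIndependent_of_top_le_span_of_card_eq_finrank (top_le_span_complexFrame e)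
    (Module.finrank_eq_card_basis (Algebra.TensorProduct.basis ℂ e.toBasis)).symm

theorem eq_zero_of_sum_tmul_complexFrame_eq_zero [FiniteDimensional ℝ E]
    [IsManifold 𝓘(ℝ, E) ∞ M] {A : Type*} [AddCommGroup A] [Module ℂ A]
    {a : Fin n ⊕ Fin n → A} (h : ∑ i, a i ⊗ₜ[ℂ] complexFrame e i = 0) : a = 0 := by
  let b := Module.Basis.mk (linearIndependent_complexFrame e) (top_le_span_complexFrame e)
  have := TensorProduct.sum_tmul_basis_right_eq_zero b (Finsupp.equivFunOnFinite.symm a) (by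
    rw [Finsupp.sum_fintype _ _ (by simp)]
    simpa [b] using h)
  exact funext fun i ↦ congr($this i)

variable (H : TangentSpace 𝓘(ℝ, E) x [⋀^Fin 3]→ₗ[ℝ] ℂ)

theorem components_eq_sum (i j k : Fin n ⊕ Fin n) :
    components e H i j k =
      ∑ μ, twoFormComponent e j k (H.curryLeft (e μ)) * frameCoeff μ i := by
  simp only [components, twoFormComponent_apply, AlternatingMap.curryLeft_apply_apply,
    Finset.sum_mul]
  refine Finset.sum_congr rfl fun μ _ ↦ Finset.sum_congr rfl fun ν _ ↦
    Finset.sum_congr rfl fun κ _ ↦ ?_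
  ring

theorem components_swap (i j k : Fin n ⊕ Fin n) :
    components e H i j k = -components e H i k j := by
  have hskew (α : TangentSpace 𝓘(ℝ, E) x [⋀^Fin 2]→ₗ[ℝ] ℂ) :
      twoFormComponent e j k α = -twoFormComponent e k j α := by
    rw [twoFormComponent_apply, twoFormComponent_apply, Finset.sum_comm]
    simp only [← Finset.sum_neg_distrib]
    refine Finset.sum_congr rfl fun κ _ ↦ Finset.sum_congr rfl fun ν _ ↦ ?_
    rw [map_vecCons_vecCons_swap α (e κ) (e ν)]
    ring
  simp [components_eq_sum, hskew]

theorem twoFormComponent_curryLeft_eq_zero {e} {H} {j k : Fin n ⊕ Fin n}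
    (h : ∀ i, components e H i j k = 0) (Y : TangentSpace 𝓘(ℝ, E) x) :
    twoFormComponent e j k (H.curryLeft Y) = 0 := by
  have hframe := eq_zero_of_sum_mul_frameCoeff_eq_zero fun i ↦
    (components_eq_sum e H i j k).symm.trans (h i)
  have : (twoFormComponent e j k).comp H.curryLeft = 0 :=
    e.toBasis.ext fun μ ↦ by simpa using congr($hframe μ)
  exact congr($this Y)

end ComplexFrame

theorem sum_sum_smul_apply_eq_sum_twoFormComponent {n : ℕ} {W V N : Type*} [AddCommGroup W]
    [Module ℝ W] [AddCommGroup V] [Module ℂ V] [AddCommGroup N] [Module ℂ N]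
    (e : Fin n ⊕ Fin n → W) (α : W [⋀^Fin 2]→ₗ[ℝ] ℂ) (b : V →ₗ[ℂ] V →ₗ[ℂ] N)
    {u : Fin n ⊕ Fin n → V} {v : Fin n → V}
    (hu : ∀ μ, u μ = ∑ a, frameCoeff μ (.inl a) • v a) :
    ∑ μ, ∑ κ, α ![e μ, e κ] • b (u μ) (u κ) =
      ∑ a, ∑ c, twoFormComponent e (.inl a) (.inl c) α • b (v a) (v c) := by
  have hb (μ κ : Fin n ⊕ Fin n) : α ![e μ, e κ] • b (u μ) (u κ) = ∑ a, ∑ c,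
      (α ![e μ, e κ] * frameCoeff μ (.inl a) * frameCoeff κ (.inl c)) • b (v a) (v c) := by
    simp only [hu, map_sum, map_smul, LinearMap.sum_apply, LinearMap.smul_apply, Finset.smul_sum,
      smul_smul]
    rw [Finset.sum_comm]
    refine Finset.sum_congr rfl fun a _ ↦ Finset.sum_congr rfl fun c _ ↦ ?_
    congr 1
    ring
  simp only [hb, twoFormComponent_apply, Finset.sum_smul]
  rw [Finset.sum_comm_cycle]
  refine Finset.sum_congr rfl fun a _ ↦ ?_
  rw [Finset.sum_comm_cycle]

section ComplexFrameInner

variable {n : ℕ} {E : Type*} [NormedAddCommGroup E] [NormedSpace ℝ E]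
  {M : Type*} [TopologicalSpace M] [ChartedSpace E M]
  [RiemannianBundle (fun x : M ↦ TangentSpace 𝓘(ℝ, E) x)]

/-- The complex bilinear extension of the metric to `T_x M ⊗ ℂ`. -/
def innerC (x : M) : LinearMap.BilinForm ℂ (ℂ ⊗[ℝ] TangentSpace 𝓘(ℝ, E) x) :=
  LinearMap.BilinForm.baseChange ℂ (innerₗ (TangentSpace 𝓘(ℝ, E) x))

theorem innerC_tmul {x : M} (c d : ℂ) (X Y : TangentSpace 𝓘(ℝ, E) x) :
    innerC x (c ⊗ₜ X) (d ⊗ₜ Y) = (inner ℝ X Y : ℂ) * (c * d) := by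
  simp [innerC, mul_comm]

variable {x : M} (e : OrthonormalBasis (Fin n ⊕ Fin n) ℝ (TangentSpace 𝓘(ℝ, E) x)) (a b : Fin n)

theorem innerC_complexFrame_inl_inl :
    innerC x (complexFrame e (.inl a)) (complexFrame e (.inl b)) = 0 := by
  by_cases h : a = b <;> simp [complexFrame, innerC_tmul, e.inner_eq_ite, h]

theorem innerC_complexFrame_inr_inl :
    innerC x (complexFrame e (.inr a)) (complexFrame e (.inl b)) = if a = b then 2 else 0 := by
  by_cases h : a = b <;> simp [complexFrame, innerC_tmul, e.inner_eq_ite, h]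
  norm_num

end ComplexFrameInner

variable {n : ℕ} {E : Type*} [NormedAddCommGroup E] [NormedSpace ℝ E]
  {M : Type*} [TopologicalSpace M] [ChartedSpace E M] [IsManifold 𝓘(ℝ, E) ∞ M]
  [RiemannianBundle (fun x : M ↦ TangentSpace 𝓘(ℝ, E) x)]
  {F : Type*} [NormedAddCommGroup F] [NormedSpace ℂ F]
  {S : M → Type*} [TopologicalSpace (TotalSpace F S)]
  [∀ x, AddCommGroup (S x)] [∀ x, Module ℂ (S x)] [∀ x, TopologicalSpace (S x)]
  [FiberBundle F S]

namespace SpinorBundle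

section ChargeConjugation

variable (B : SpinorBundle n E M F S)

theorem C_γ_γ {x : M} (X Y : TangentSpace 𝓘(ℝ, E) x) (φ ψ : S x) :
    B.C x φ (B.γ x X (B.γ x Y ψ)) = B.C x (B.γ x Y (B.γ x X φ)) ψ := by
  have hγ (X : TangentSpace 𝓘(ℝ, E) x) (φ ψ : S x) :
      B.C x φ (B.γ x X ψ) = ((B.Δ₁ * B.Δ₀ : ℤˣ) : ℂ) * B.C x (B.γ x X φ) ψ := by
    rw [B.symm_C_γ, B.symm_C x ψ]
    push_cast
    ring
  have hsign : ((B.Δ₁ * B.Δ₀ : ℤˣ) : ℂ) * ((B.Δ₁ * B.Δ₀ : ℤˣ) : ℂ) = 1 := by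
    rcases Int.units_eq_one_or (B.Δ₁ * B.Δ₀) with h | h <;> simp only [h] <;> norm_num
  rw [hγ, hγ, ← mul_assoc, hsign, one_mul]

variable [FiniteDimensional ℝ E]

theorem chargeAdj_antisymmProd_two {x : M} (X Y : TangentSpace 𝓘(ℝ, E) x) :
    B.chargeAdj x (antisymmProd ![B.γ x X, B.γ x Y]) = -antisymmProd ![B.γ x X, B.γ x Y] := by
  refine B.chargeAdj_eq fun φ ψ ↦ ?_
  simp only [antisymmProd_two, LinearMap.neg_apply, LinearMap.smul_apply, LinearMap.sub_apply,
    Module.End.mul_apply, map_neg, map_smul, map_sub, C_γ_γ, smul_eq_mul]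
  ring

theorem chargeAdj_threeFormPotential (H : ∀ x : M, TangentSpace 𝓘(ℝ, E) x [⋀^Fin 3]→ₗ[ℝ] ℂ)
    {x : M} (v : TangentSpace 𝓘(ℝ, E) x) :
    B.chargeAdj x (B.threeFormPotential H x v) = -B.threeFormPotential H x v := by
  refine B.chargeAdj_eq fun φ ψ ↦ ?_
  simp only [threeFormPotential, LinearMap.coe_mk, AddHom.coe_mk, LinearMap.neg_apply,
    LinearMap.sum_apply, map_sum, LinearMap.smul_apply, map_smul, map_neg, ← C_chargeAdj,
    chargeAdj_antisymmProd_two, Finset.sum_neg_distrib, smul_neg]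

end ChargeConjugation

section CliffordRelations

variable (B : SpinorBundle n E M F S) {x : M}

theorem γC_tmul [FiniteDimensional ℝ E] (c : ℂ) (X : TangentSpace 𝓘(ℝ, E) x) :
    B.γC x (c ⊗ₜ X) = c • B.γ x X := by
  simp [γC]

theorem γC_mul_γC_add_γC_mul_γC [FiniteDimensional ℝ E] (Z W : ℂ ⊗[ℝ] TangentSpace 𝓘(ℝ, E) x) :
    B.γC x Z * B.γC x W + B.γC x W * B.γC x Z = (-2 * innerC x Z W) • 1 := by
  induction Z with
  | zero => simp
  | add Z Z' hZ hZ' =>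
    simp only [map_add, LinearMap.add_apply, mul_add, add_mul, add_smul, ← hZ, ← hZ']
    abel
  | tmul c X =>
    induction W with
    | zero => simp
    | add W W' hW hW' =>
      simp only [map_add, mul_add, add_mul, add_smul, ← hW, ← hW']
      abel
    | tmul d Y =>
      have h := B.clifford x X Y
      rw [← Complex.coe_smul] at h
      simp only [γC_tmul, innerC_tmul, smul_mul_smul_comm]
      push_cast at h
      linear_combination (norm := module) (c * d) • h

theorem gammaStar_mul_γ [FiniteDimensional ℝ E]
    (f : OrthonormalBasis (Fin (2 * n)) ℝ (TangentSpace 𝓘(ℝ, E) x))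
    (X : TangentSpace 𝓘(ℝ, E) x) : B.gammaStar f * B.γ x X = -(B.γ x X * B.gammaStar f) := by
  have hframe (a b) (hab : a ≠ b) : B.γ x (f a) * B.γ x (f b) = -(B.γ x (f b) * B.γ x (f a)) := by
    have h := B.clifford x (f a) (f b)
    rw [f.inner_eq_zero hab, mul_zero, zero_smul] at h
    exact eq_neg_of_add_eq_zero_left h
  have hbasis (a) : B.gammaStar f * B.γ x (f a) = -(B.γ x (f a) * B.gammaStar f) := by
    have h := mul_list_prod_map_of_mem (R := ℂ) (g := fun μ ↦ B.γ x (f μ)) hframe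
      (List.nodup_finRange (2 * n)) (List.mem_finRange a)
    rw [← List.ofFn_eq_map, List.length_finRange, Odd.neg_one_pow (by simp), neg_one_smul] at h
    rw [gammaStar, mul_smul_comm, h, smul_mul_assoc, smul_neg, neg_neg]
  rw [← f.sum_repr' X]
  simp only [map_sum, map_smul, Finset.mul_sum, Finset.sum_mul, ← Finset.sum_neg_distrib,
    mul_smul_comm, smul_mul_assoc, hbasis, smul_neg]

theorem gammaStar_mul_γC [FiniteDimensional ℝ E]
    (f : OrthonormalBasis (Fin (2 * n)) ℝ (TangentSpace 𝓘(ℝ, E) x))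
    (Z : ℂ ⊗[ℝ] TangentSpace 𝓘(ℝ, E) x) :
    B.gammaStar f * B.γC x Z = -(B.γC x Z * B.gammaStar f) := by
  induction Z with
  | zero => simp
  | add Z Z' hZ hZ' => rw [map_add, mul_add, add_mul, hZ, hZ', neg_add]
  | tmul c X => rw [γC_tmul, mul_smul_comm, smul_mul_assoc, gammaStar_mul_γ, smul_neg]

theorem γC_unbarred_anticomm [FiniteDimensional ℝ E]
    (e : OrthonormalBasis (Fin n ⊕ Fin n) ℝ (TangentSpace 𝓘(ℝ, E) x)) (a b : Fin n) :
    B.γC x (complexFrame e (.inl a)) * B.γC x (complexFrame e (.inl b)) =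
      -(B.γC x (complexFrame e (.inl b)) * B.γC x (complexFrame e (.inl a))) :=
  eq_neg_of_add_eq_zero_left <| by
    rw [γC_mul_γC_add_γC_mul_γC, innerC_complexFrame_inl_inl, mul_zero, zero_smul]

end CliffordRelations

section Adapted

variable [FiniteDimensional ℝ E] {B : SpinorBundle n E M F S} {x : M}
  {e : OrthonormalBasis (Fin n ⊕ Fin n) ℝ (TangentSpace 𝓘(ℝ, E) x)} {η : S x}

theorem IsAdapted.γC_barred_apply (he : B.IsAdapted e η) (a : Fin n) :
    B.γC x (complexFrame e (.inr a)) η = 0 := by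
  simpa [complexFrame, γC_tmul] using he a

theorem IsAdapted.γ_apply_eq_sum (he : B.IsAdapted e η) (μ : Fin n ⊕ Fin n) :
    B.γ x (e μ) η = ∑ a, frameCoeff μ (.inl a) • B.γC x (complexFrame e (.inl a)) η := by
  have h := congr(B.γC x $(sum_frameCoeff e μ) η)
  rw [γC_tmul, one_smul] at h
  rw [← h, map_sum, LinearMap.sum_apply, Fintype.sum_sum_type]
  simp [he.γC_barred_apply]

theorem IsAdapted.prod_γC_apply_ne_zero (he : B.IsAdapted e η) (hη : η ≠ 0) :
    (List.ofFn fun a : Fin n ↦ B.γC x (complexFrame e (.inl a))).prod η ≠ 0 := by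
  have hc : IsUnit (-4 : ℂ) := IsUnit.mk0 _ (by norm_num)
  rw [List.ofFn_eq_map]
  refine list_prod_map_apply_ne_zero (h := fun a ↦ B.γC x (complexFrame e (.inr a))) hc
    (fun a b ↦ ?_) hη he.γC_barred_apply (List.nodup_finRange n)
  rw [γC_mul_γC_add_γC_mul_γC, innerC_complexFrame_inr_inl]
  split_ifs <;> norm_num

end Adapted

theorem components_eq_zero_of_obstruction_eq_zero [FiniteDimensional ℝ E]
    {B : SpinorBundle n E M F S} {hn : 2 ≤ n} {x : M}
    {e : OrthonormalBasis (Fin n ⊕ Fin n) ℝ (TangentSpace 𝓘(ℝ, E) x)}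
    {H : TangentSpace 𝓘(ℝ, E) x [⋀^Fin 3]→ₗ[ℝ] ℂ}
    {f : OrthonormalBasis (Fin (2 * n)) ℝ (TangentSpace 𝓘(ℝ, E) x)} {w : ℂ} {η : S x}
    (hη : η ≠ 0) (hw : B.gammaStar f η = w • η) (he : B.IsAdapted e η)
    (hH : B.obstruction hn e H (B.gammaStar f) w = 0) (i : Fin n ⊕ Fin n) (a b : Fin n) :
    components e H i (.inl a) (.inl b) = 0 := by
  obtain ⟨m, rfl⟩ : ∃ m, n = m + 2 := ⟨n - 2, by omega⟩
  simp only [obstruction, ← TensorProduct.sum_tmul] at hH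
  have hi := congr_fun (eq_zero_of_sum_tmul_complexFrame_eq_zero e hH) i
  rw [pow_add, neg_one_sq, mul_one] at hi
  exact eq_zero_of_sum_perm_smul_antisymmProd_mul_eq_zero (B.γC_unbarred_anticomm e)
    (fun _ ↦ B.gammaStar_mul_γC f _) hw (he.prod_γC_apply_ne_zero hη)
    (G := fun a b ↦ components e H i (.inl a) (.inl b))
    (fun _ _ ↦ components_swap e H i _ _) hi a b

section Torsion

variable [FiniteDimensional ℝ E] [∀ x, IsTopologicalAddGroup (S x)] [∀ x, ContinuousSMul ℝ (S x)]

/-- A Clifford connection: a connection on the spinor bundle for which, together with the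
connection `nablaM` on the tangent bundle, Clifford multiplication is parallel. -/
def IsCliffordConnection (B : SpinorBundle n E M F S)
    (nablaM : CovariantDerivative 𝓘(ℝ, E) E (fun x : M ↦ TangentSpace 𝓘(ℝ, E) x))
    (nablaS : CovariantDerivative 𝓘(ℝ, E) F S) : Prop :=
  ∀ (X : ∀ x : M, TangentSpace 𝓘(ℝ, E) x) (σ : ∀ x, S x) (x : M) (v : TangentSpace 𝓘(ℝ, E) x),
    MDifferentiableAt 𝓘(ℝ, E) (𝓘(ℝ, E).prod 𝓘(ℝ, E)) (fun y ↦ TotalSpace.mk' E y (X y)) x →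
    MDifferentiableAt 𝓘(ℝ, E) (𝓘(ℝ, E).prod 𝓘(ℝ, F)) (fun y ↦ TotalSpace.mk' F y (σ y)) x →
    nablaS (fun y ↦ B.γ y (X y) (σ y)) x v =
      B.γ x (nablaM X x v) (σ x) + B.γ x (X x) (nablaS σ x v)

variable {B : SpinorBundle n E M F S}
  {nablaM : CovariantDerivative 𝓘(ℝ, E) E (fun x : M ↦ TangentSpace 𝓘(ℝ, E) x)}
  {nablaS : CovariantDerivative 𝓘(ℝ, E) F S}

theorem IsCliffordConnection.hatD_γ_eq (hS : B.IsCliffordConnection nablaM nablaS)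
    (A : ∀ x : M, TangentSpace 𝓘(ℝ, E) x →ₗ[ℝ] Module.End ℂ (S x)) {x : M}
    (v X : TangentSpace 𝓘(ℝ, E) x) (ξ : S x) :
    hatD_γ B nablaM (addForm nablaS A) (B.connC nablaS A) v X ξ =
      A x v (B.γ x X ξ) + B.γ x X (B.chargeAdj x (A x v) ξ) := by
  have h := hS (FiberBundle.extend E X) (FiberBundle.extend F ξ) x v
    (FiberBundle.mdifferentiableAt_extend 𝓘(ℝ, E) E X)
    (FiberBundle.mdifferentiableAt_extend 𝓘(ℝ, E) F ξ)
  simp only [FiberBundle.extend_apply_self] at h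
  rw [hatD_γ, connC, addForm_apply, addForm_apply, h]
  simp [chargeAdjForm]
  abel

theorem IsCliffordConnection.torsion_threeFormPotential (hS : B.IsCliffordConnection nablaM nablaS)
    (H : ∀ x : M, TangentSpace 𝓘(ℝ, E) x [⋀^Fin 3]→ₗ[ℝ] ℂ) {x : M}
    (X Y : TangentSpace 𝓘(ℝ, E) x) (ξ : S x) :
    B.torsion nablaM nablaS (B.threeFormPotential H) X Y ξ =
      (8 : ℂ) • ∑ κ, H x ![X, Y, frame x κ] • B.γ x (frame x κ) ξ := by
  have hcomm (X Y : TangentSpace 𝓘(ℝ, E) x) :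
      B.threeFormPotential H x X (B.γ x Y ξ) - B.γ x Y (B.threeFormPotential H x X ξ) =
        (4 : ℂ) • ∑ κ, H x ![X, Y, frame x κ] • B.γ x (frame x κ) ξ := by
    have h := congr($(sum_smul_antisymmProd_mul_sub_mul (B.clifford x) (frame x)
      ((H x).curryLeft X) Y) ξ)
    rw [LinearMap.smul_apply, LinearMap.sum_apply] at h
    exact h
  rw [torsion, hS.hatD_γ_eq, hS.hatD_γ_eq]
  simp only [chargeAdj_threeFormPotential, LinearMap.neg_apply, map_neg, ← sub_eq_add_neg, hcomm,
    map_vecCons_vecCons_swap (H x) X Y, neg_smul, Finset.sum_neg_distrib]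
  module

end Torsion

theorem sum_sum_smul_wedge_eq_zero [FiniteDimensional ℝ E] {B : SpinorBundle n E M F S} {x : M}
    {e : OrthonormalBasis (Fin n ⊕ Fin n) ℝ (TangentSpace 𝓘(ℝ, E) x)} {η : S x}
    (he : B.IsAdapted e η) {H : TangentSpace 𝓘(ℝ, E) x [⋀^Fin 3]→ₗ[ℝ] ℂ}
    (hH : ∀ i a b, components e H i (.inl a) (.inl b) = 0) {ι : Type*} [Fintype ι]
    (f : OrthonormalBasis ι ℝ (TangentSpace 𝓘(ℝ, E) x)) (Y : TangentSpace 𝓘(ℝ, E) x) :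
    ∑ μ, ∑ κ, H ![Y, f μ, f κ] • exteriorPower.ιMulti ℂ 2 ![B.γ x (f μ) η, B.γ x (f κ) η] = 0 := by
  let wedge := bilinOfAlternating (exteriorPower.ιMulti ℂ 2 (M := S x))
  let γη : TangentSpace 𝓘(ℝ, E) x →ₗ[ℝ] S x :=
    ((LinearMap.applyₗ (R := ℂ) η).restrictScalars ℝ).comp (B.γ x)
  calc _ = ∑ μ, ∑ κ, H.curryLeft Y ![e μ, e κ] • wedge (γη (e μ)) (γη (e κ)) :=
        sum_sum_smul_orthonormalBasis_eq (bilinOfAlternating (H.curryLeft Y))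
          ((wedge.restrictScalars₁₂ ℝ ℝ).compl₁₂ γη γη) f e
    _ = ∑ a, ∑ b, twoFormComponent e (.inl a) (.inl b) (H.curryLeft Y) •
          wedge (B.γC x (complexFrame e (.inl a)) η) (B.γC x (complexFrame e (.inl b)) η) :=
        sum_sum_smul_apply_eq_sum_twoFormComponent e (H.curryLeft Y) wedge he.γ_apply_eq_sum
    _ = 0 := by
        simp [twoFormComponent_curryLeft_eq_zero fun i ↦ hH i _ _]

theorem sum_wedge_torsion_eq_zero [FiniteDimensional ℝ E] [∀ x, IsTopologicalAddGroup (S x)]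
    [∀ x, ContinuousSMul ℝ (S x)] {B : SpinorBundle n E M F S}
    {nablaM : CovariantDerivative 𝓘(ℝ, E) E (fun x : M ↦ TangentSpace 𝓘(ℝ, E) x)}
    {nablaS : CovariantDerivative 𝓘(ℝ, E) F S} (hS : B.IsCliffordConnection nablaM nablaS)
    {H : ∀ x : M, TangentSpace 𝓘(ℝ, E) x [⋀^Fin 3]→ₗ[ℝ] ℂ} {x : M}
    {e : OrthonormalBasis (Fin n ⊕ Fin n) ℝ (TangentSpace 𝓘(ℝ, E) x)} {η : S x}
    (he : B.IsAdapted e η) (hH : ∀ i a b, components e (H x) i (.inl a) (.inl b) = 0)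
    (Y : TangentSpace 𝓘(ℝ, E) x) :
    ∑ μ, exteriorPower.ιMulti ℂ 2 ![B.γ x (frame x μ) η,
      B.torsion nablaM nablaS (B.threeFormPotential H) (frame x μ) Y η] = 0 := by
  calc _ = ∑ μ, bilinOfAlternating (exteriorPower.ιMulti ℂ 2) (B.γ x (frame x μ) η)
        ((8 : ℂ) • ∑ κ, H x ![frame x μ, Y, frame x κ] • B.γ x (frame x κ) η) := by
        simp only [hS.torsion_threeFormPotential, bilinOfAlternating_apply]
    _ = (-8 : ℂ) • ∑ μ, ∑ κ, H x ![Y, frame x μ, frame x κ] •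
          exteriorPower.ιMulti ℂ 2 ![B.γ x (frame x μ) η, B.γ x (frame x κ) η] := by
        simp only [map_smul, map_sum, bilinOfAlternating_apply, Finset.smul_sum, smul_smul,
          map_vecCons_vecCons_swap (H x) Y, mul_neg, neg_mul]
    _ = 0 := by rw [sum_sum_smul_wedge_eq_zero he hH, smul_zero]

end SpinorBundle

end SpinorTorsion

end

theorem proposition5p9_general {n : ℕ} (hn : 2 ≤ n)
    {E : Type*} [NormedAddCommGroup E] [NormedSpace ℝ E] [FiniteDimensional ℝ E]
    {M : Type*} [TopologicalSpace M] [ChartedSpace E M] [IsManifold 𝓘(ℝ, E) ∞ M]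
    [RiemannianBundle (fun x : M ↦ TangentSpace 𝓘(ℝ, E) x)]
    {F : Type*} [NormedAddCommGroup F] [NormedSpace ℂ F]
    {S : M → Type*} [TopologicalSpace (TotalSpace F S)]
    [∀ x, AddCommGroup (S x)] [∀ x, Module ℂ (S x)] [∀ x, TopologicalSpace (S x)]
    [∀ x, IsTopologicalAddGroup (S x)] [∀ x, ContinuousSMul ℝ (S x)] [FiberBundle F S]
    (B : SpinorTorsion.SpinorBundle n E M F S)
    (nablaM : CovariantDerivative 𝓘(ℝ, E) E (fun x : M ↦ TangentSpace 𝓘(ℝ, E) x))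
    (nablaS : CovariantDerivative 𝓘(ℝ, E) F S) (hS : B.IsCliffordConnection nablaM nablaS)
    (H : ∀ x : M, TangentSpace 𝓘(ℝ, E) x [⋀^Fin 3]→ₗ[ℝ] ℂ)
    (η : ∀ x, S x) (x : M) (f : OrthonormalBasis (Fin (2 * n)) ℝ (TangentSpace 𝓘(ℝ, E) x))
    (w : ℂ) (hw : B.gammaStar f (η x) = w • η x)
    (e : OrthonormalBasis (Fin n ⊕ Fin n) ℝ (TangentSpace 𝓘(ℝ, E) x))
    (he : B.IsAdapted e (η x))
    (hH : B.obstruction hn e (H x) (B.gammaStar f) w = 0) :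
    B.frakD (fun _ ↦ B.torsion nablaM nablaS (B.threeFormPotential H)) η η x = 0 := by
  have hwedge (Y : TangentSpace 𝓘(ℝ, E) x) :
      ∑ μ, exteriorPower.ιMulti ℂ 2 ![B.γ x (SpinorTorsion.frame x μ) (η x),
        B.torsion nablaM nablaS (B.threeFormPotential H) (SpinorTorsion.frame x μ) Y (η x)] =
        0 := by
    rcases eq_or_ne (η x) 0 with hη | hη
    · exact Finset.sum_eq_zero fun μ _ ↦
        (exteriorPower.ιMulti ℂ 2).map_coord_zero 0 (by simp [hη])
    · exact SpinorTorsion.SpinorBundle.sum_wedge_torsion_eq_zero hS he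
        (SpinorTorsion.SpinorBundle.components_eq_zero_of_obstruction_eq_zero hη hw he hH) Y
  rw [SpinorTorsion.SpinorBundle.frakD, Finset.sum_comm]
  refine Finset.sum_eq_zero fun ν _ ↦ ?_
  rw [← TensorProduct.sum_tmul, Finset.sum_add_distrib, hwedge, add_zero, TensorProduct.zero_tmul]

theorem proposition5p9 {n : ℕ} (hn : 2 ≤ n)
    -- a smooth Riemannian manifold `M` of dimension `2 * n`
    {E : Type*} [NormedAddCommGroup E] [NormedSpace ℝ E] [FiniteDimensional ℝ E]
    {M : Type*} [TopologicalSpace M] [ChartedSpace E M] [IsManifold 𝓘(ℝ, E) ∞ M]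
    [RiemannianBundle (fun x : M ↦ TangentSpace 𝓘(ℝ, E) x)]
    [IsContMDiffRiemannianBundle 𝓘(ℝ, E) ∞ E (fun x : M ↦ TangentSpace 𝓘(ℝ, E) x)]
    -- a spinor bundle `S` with charge conjugation
    {F : Type*} [NormedAddCommGroup F] [NormedSpace ℂ F]
    {S : M → Type*} [TopologicalSpace (TotalSpace F S)]
    [∀ x, AddCommGroup (S x)] [∀ x, Module ℂ (S x)] [∀ x, TopologicalSpace (S x)]
    [∀ x, IsTopologicalAddGroup (S x)] [∀ x, ContinuousSMul ℝ (S x)]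
    [FiberBundle F S] [VectorBundle ℂ F S] [VectorBundle ℝ F S]
    [ContMDiffVectorBundle ∞ F S 𝓘(ℝ, E)]
    (B : SpinorTorsion.SpinorBundle n E M F S)
    -- the Levi-Civita connections on `M` and on `S`
    (nablaM : CovariantDerivative 𝓘(ℝ, E) E (fun x : M ↦ TangentSpace 𝓘(ℝ, E) x))
    (hM : SpinorTorsion.IsLeviCivita nablaM)
    (nablaS : CovariantDerivative 𝓘(ℝ, E) F S)
    (hS : B.IsSpinLeviCivita nablaM nablaS)
    -- a three-form `H`, which gives `D = ∇ + 𝒜`, and a pure spinor field `η`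
    (H : ∀ x : M, TangentSpace 𝓘(ℝ, E) x [⋀^Fin 3]→ₗ[ℝ] ℂ)
    (η : ∀ x, S x) (hη : B.IsPure η)
    -- at the point `x`: `γ^*` for an orthonormal frame `f`, the chirality `w` of `η`, and an
    -- orthonormal frame `e` adapted to the complex structure given by `η`
    (x : M) (f : OrthonormalBasis (Fin (2 * n)) ℝ (TangentSpace 𝓘(ℝ, E) x))
    (w : ℂ) (hw : B.gammaStar f (η x) = w • η x)
    (e : OrthonormalBasis (Fin n ⊕ Fin n) ℝ (TangentSpace 𝓘(ℝ, E) x))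
    (he : B.IsAdapted e (η x))
    (hH : B.obstruction hn e (H x) (B.gammaStar f) w = 0) :
    B.frakD (fun _ ↦ B.torsion nablaM nablaS (B.threeFormPotential H)) η η x = 0 :=
  proposition5p9_general hn B nablaM nablaS hS.parallel_γ H η x f w hw e he hH
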